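/- **Definitions.** A *network* is a labeled graph $G=(V,E,\ell)$, where $(V,E)$ is a finite undirected graph (self-loops allowed) and $\ell$ assigns a non-negative integer $\ell(u,v)$ to each ordered pair $(u,v)$ with $\{u,v\}\in E$. An *automorphism* of $G$ is a permutation of $V$ that preserves adjacencies and labels. The *girth* of $G$ is the length of a shortest cycle of $(V,E)$, a self-loop being a cycle of length $1$, and it is $\infty$ if there are no cycles. For $n\ge 1$ let $\mathbb N_n=\{0,\dots,n-1\}$. An *arrangement* of $k\geq 1$ robots on $G$ is a map $a\colon\mathbb N_k\to V$. Two arrangements $a_1,a_2$ are *equivalent under* $(\alpha,\pi)$, where $\alpha$ is an automorphism of $G$ and $\pi$ is a permutation of $\mathbb N_k$, if $\alpha\circ a_1=a_2\circ\pi$; they are *equivalent* if this holds for some $(\alpha,\pi)$. The equivalence classes of arrangements are called *configurations*, and $\mathcal C(G,k)$ is the set of all of them. Two vertices $v,v'$ are equivalent in $a$ if $\alpha(v)=v'$ for some $(\alpha,\pi)$ under which $a$ is equivalent to itself. A *class of indistinguishable vertices* $U$ of a configuration $C$ assigns to each $a\in C$ an equivalence class $U(a)$ of vertices in $a$, in such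 a way that $\alpha(U(a_1))=U(a_2)$ whenever $a_1,a_2\in C$ are equivalent under $(\alpha,\pi)$. An *algorithm* $A$ for $k$ robots on $G$ maps each pair $(C,U)$, where $C\in\mathcal C(G,k)$ and $U$ is a class of indistinguishable vertices of $C$, to a class $U'=A(C,U)$ of indistinguishable vertices of $C$ such that, for all $a\in C$ and $u\in U(a)$, some $u'\in U'(a)$ is equal or adjacent to $u$. An *execution* is a sequence $(C_i)_{i\ge0}$ of configurations, a *scheduler* $S$ is a binary relation between algorithms and executions, and a *system* is a triplet $\Psi=(G,k,S)$. The executions of $A$ under $\Psi$ are those related to $A$ by $S$. A configuration $C'$ *yields* from $C$ under $A$ if for every $a\in C$ there is $a'\in C'$ such that, for every $r\in\mathbb N_k$, $a'(r)$ is equal or adjacent to $a(r)$, and $a'(r)\in A(C,U)(a)$, where $U$ is the class of indistinguishable vertices of $C$ with $a(r)\in U(a)$. The *fully synchronous scheduler* $\mathcal F$ relates $A$ to $(C_i)_{i\geq 0}$ if and only if $C_{i+1}$ yields from $C_i$ under $A$ for all $i\geq 0$. An algorithm $A$ under $\Psi=(G,k,S)$ *simulates* an algorithm $A'$ under $\Psi'=(G',k',S')$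 if there is a surjective partial function $\varphi\colon\mathcal C(G,k)\to\mathcal C(G',k')$ such that for every execution $(C_i)_{i\geq 0}$ of $A$ under $\Psi$ there is an execution $(C_i')_{i\geq 0}$ of $A'$ under $\Psi'$ satisfying one of the following: either $\varphi$ is undefined on $C_0$, or there is a weakly increasing surjection $\sigma\colon\mathbb N\to\mathbb N$ such that, for all $i\geq 0$, $\varphi(C_i)$ is defined and equal to $C'_{\sigma(i)}$. For $f\colon\mathbb N_n\to\mathbb N_n$, let $\Gamma_f$ be the network with vertex set $\mathbb N_n$, edges $\{x,f(x)\}$ for $x\in\mathbb N_n$, and labels $\ell(u,v)=v$, and let $A_f$ be the algorithm for one robot on $\Gamma_f$ that always moves the robot from $x$ to $f(x)$. A system $\Psi$ *computes* $f$ if some algorithm under $\Psi$ simulates $A_f$ under $(\Gamma_f,1,\mathcal F)$. A set of systems is *universal* if for every $n\ge1$ and every $f\colon\mathbb N_n\to\mathbb N_n$ it contains a system that computes $f$. **Theorem.** Let $(G_n)_{n\in\mathbb N}$ be a sequence of networks such that, for every $n$, the girth of $G_n$ is finite and at least $n$. Then the set of systems $\{(G_n,3,\mathcal F)\mid n\in\mathbb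 N\}$ is universal. -/

import Mathlib

universe u v

/-- A network: a finite undirected graph, possibly with self-loops, in which every ordered pair
of adjacent vertices carries a natural number as label. The values of `label` on non-adjacent
pairs carry no information and are never used. -/
structure Network : Type (u + 1) where
  V : Type u
  finite : Finite V
  Adj : V → V → Prop
  symm : ∀ x y, Adj x y → Adj y x
  label : V → V → ℕ

namespace Network

/-- The automorphisms of a labeled graph. The vertex set is finite, so a permutation
that preserves adjacency also reflects it. -/
def IsAut (G : Network.{u}) (α : Equiv.Perm G.V) : Prop :=
  (∀ x y, G.Adj x y ↔ G.Adj (α x) (α y)) ∧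
    ∀ x y, G.Adj x y → G.label x y = G.label (α x) (α y)

theorem IsAut.one (G : Network.{u}) : G.IsAut 1 := by
  refine ⟨fun x y => ?_, fun x y _ => ?_⟩ <;> simp

theorem IsAut.inv {G : Network.{u}} {α : Equiv.Perm G.V} (h : G.IsAut α) : G.IsAut α⁻¹ := by
  have key : ∀ x y, G.Adj x y ↔ G.Adj (α⁻¹ x) (α⁻¹ y) := fun x y => by
    simpa using (h.1 (α⁻¹ x) (α⁻¹ y)).symm
  refine ⟨key, fun x y hxy => ?_⟩
  simpa using (h.2 (α⁻¹ x) (α⁻¹ y) ((key x y).1 hxy)).symm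

theorem IsAut.mul {G : Network.{u}} {α β : Equiv.Perm G.V} (hα : G.IsAut α) (hβ : G.IsAut β) :
    G.IsAut (α * β) := by
  refine ⟨fun x y => (hβ.1 x y).trans (hα.1 _ _), fun x y hxy => ?_⟩
  exact (hβ.2 x y hxy).trans (hα.2 _ _ ((hβ.1 x y).1 hxy))

/-- The base graph with its self-loops removed. -/
def toSimpleGraph (G : Network.{u}) : SimpleGraph G.V where
  Adj x y := x ≠ y ∧ G.Adj x y
  symm := ⟨fun _ _ h => ⟨h.1.symm, G.symm _ _ h.2⟩⟩
  loopless := ⟨fun _ h => h.1 rfl⟩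

open Classical in
/-- The girth: the length of a shortest cycle, and `⊤` if there are no cycles.
A self-loop is a cycle of length one. -/
noncomputable def girth (G : Network.{u}) : ℕ∞ :=
  if ∃ x, G.Adj x x then 1 else G.toSimpleGraph.egirth

/-- Arrangements of `k` robots. -/
abbrev Arrangement (G : Network.{u}) (k : ℕ) : Type u := Fin k → G.V

/-- `a₁` and `a₂` are equivalent under the automorphism `α` and the permutation `π`. -/
def EquivUnder (G : Network.{u}) {k : ℕ} (a₁ a₂ : G.Arrangement k)
    (α : Equiv.Perm G.V) (π : Equiv.Perm (Fin k)) : Prop :=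
  G.IsAut α ∧ ⇑α ∘ a₁ = a₂ ∘ ⇑π

/-- The equivalence relation on arrangements. -/
def arrangementSetoid (G : Network.{u}) (k : ℕ) : Setoid (G.Arrangement k) where
  r a₁ a₂ := ∃ α π, G.EquivUnder a₁ a₂ α π
  iseqv := by
    refine ⟨fun a => ⟨1, 1, IsAut.one G, rfl⟩, ?_, ?_⟩
    · rintro a₁ a₂ ⟨α, π, hα, h⟩
      refine ⟨α⁻¹, π⁻¹, hα.inv, funext fun r => ?_⟩
      have h₁ : α (a₁ (π⁻¹ r)) = a₂ r := by simpa using congrFun h (π⁻¹ r)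
      change α⁻¹ (a₂ r) = a₁ (π⁻¹ r)
      rw [← h₁]
      simp
    · rintro a₁ a₂ a₃ ⟨α, π, hα, h⟩ ⟨β, ρ, hβ, h'⟩
      refine ⟨β * α, ρ * π, hβ.mul hα, funext fun r => ?_⟩
      have h₁ := congrFun h r
      have h₂ := congrFun h' (π r)
      simp only [Function.comp_apply, Equiv.Perm.mul_apply] at h₁ h₂ ⊢
      rw [h₁, h₂]

/-- The configuration space. -/
def Config (G : Network.{u}) (k : ℕ) : Type u := Quotient (G.arrangementSetoid k)

/-- The configuration of an arrangement. -/
def toConfig (G : Network.{u}) {k : ℕ} (a : G.Arrangement k) : G.Config k :=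
  Quotient.mk (G.arrangementSetoid k) a

/-- The arrangements belonging to a configuration. -/
abbrev Config.Elem {G : Network.{u}} {k : ℕ} (C : G.Config k) : Type u :=
  {a : G.Arrangement k // G.toConfig a = C}

/-- Equivalence of vertices in an arrangement. -/
def VertexEquiv (G : Network.{u}) {k : ℕ} (a : G.Arrangement k) (x y : G.V) : Prop :=
  ∃ α π, G.EquivUnder a a α π ∧ α x = y

end Network

open Network

/-- A class of indistinguishable vertices of the configuration `C`. -/
structure VertexClass {G : Network.{u}} {k : ℕ} (C : G.Config k) where
  toSet : C.Elem → Set G.V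
  isClass : ∀ a, ∃ x, toSet a = {y | G.VertexEquiv a.1 x y}
  equivariant : ∀ (a₁ a₂ : C.Elem) (α : Equiv.Perm G.V) (π : Equiv.Perm (Fin k)),
    G.EquivUnder a₁.1 a₂.1 α π → ⇑α '' toSet a₁ = toSet a₂

/-- An algorithm for `k` robots on `G`: given the configuration and the class of the vertex
at which the executing robot is located, it returns the class of the destination. -/
structure Algorithm (G : Network.{u}) (k : ℕ) where
  dest : (C : G.Config k) → VertexClass C → VertexClass C
  reachable : ∀ (C : G.Config k) (U : VertexClass C) (a : C.Elem), ∀ x ∈ U.toSet a,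
    ∃ y ∈ (dest C U).toSet a, x = y ∨ G.Adj x y

/-- An execution is a sequence of configurations. -/
abbrev Execution (G : Network.{u}) (k : ℕ) : Type u := ℕ → G.Config k

/-- A scheduler is a binary relation between algorithms and executions. -/
abbrev Scheduler (G : Network.{u}) (k : ℕ) : Type u := Algorithm G k → Execution G k → Prop

/-- The configuration `C'` yields from `C` under the algorithm `A`. -/
def Yields {G : Network.{u}} {k : ℕ} (A : Algorithm G k) (C C' : G.Config k) : Prop :=
  ∀ a : C.Elem, ∃ a' : C'.Elem, ∀ r : Fin k,
    (a.1 r = a'.1 r ∨ G.Adj (a.1 r) (a'.1 r)) ∧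
      ∀ U : VertexClass C, a.1 r ∈ U.toSet a → a'.1 r ∈ (A.dest C U).toSet a

/-- The fully synchronous scheduler. -/
def fullySynchronous (G : Network.{u}) (k : ℕ) : Scheduler G k :=
  fun A E => ∀ i, Yields A (E i) (E (i + 1))

/-- A system of oblivious mobile robots. -/
structure RobotSystem : Type (u + 1) where
  G : Network.{u}
  k : ℕ
  k_pos : 1 ≤ k
  S : Scheduler G k

/-- The fully synchronous system of `k` robots on `G`. -/
def FS (G : Network.{u}) (k : ℕ) (hk : 1 ≤ k) : RobotSystem.{u} where
  G := G
  k := k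
  k_pos := hk
  S := fullySynchronous G k

/-- `E` is compliant with `E'` under the partial function `φ` (`none` means undefined). -/
def Compliant {G : Network.{u}} {k : ℕ} {G' : Network.{v}} {k' : ℕ}
    (φ : G.Config k → Option (G'.Config k')) (E : Execution G k) (E' : Execution G' k') : Prop :=
  φ (E 0) = none ∨
    ∃ σ : ℕ → ℕ, Monotone σ ∧ Function.Surjective σ ∧ ∀ i, φ (E i) = some (E' (σ i))

/-- The algorithm `A` under the system `Ψ` simulates the algorithm `A'` under the system `Ψ'`. -/
def Simulates (Ψ : RobotSystem.{u}) (A : Algorithm Ψ.G Ψ.k)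
    (Ψ' : RobotSystem.{v}) (A' : Algorithm Ψ'.G Ψ'.k) : Prop :=
  ∃ φ : Ψ.G.Config Ψ.k → Option (Ψ'.G.Config Ψ'.k),
    (∀ C', ∃ C, φ C = some C') ∧
      ∀ E, Ψ.S A E → ∃ E', Ψ'.S A' E' ∧ Compliant φ E E'

/-- The network induced by a function `f`: its edges are the pairs `{x, f x}`, and the label of
`(x, y)` is `y`. -/
def inducedNetwork {n : ℕ} (f : Fin n → Fin n) : Network.{0} where
  V := Fin n
  finite := inferInstance
  Adj x y := y = f x ∨ x = f y
  symm _ _ h := h.symm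
  label _ y := y.val

theorem inducedNetwork_isAut {n : ℕ} (f : Fin n → Fin n)
    {α : Equiv.Perm (inducedNetwork f).V} (h : (inducedNetwork f).IsAut α)
    (x : (inducedNetwork f).V) : α x = x :=
  (Fin.ext (h.2 (f x) x (Or.inr rfl))).symm

theorem inducedNetwork_vertexEquiv {n k : ℕ} (f : Fin n → Fin n)
    (a : (inducedNetwork f).Arrangement k) (x y : (inducedNetwork f).V) :
    (inducedNetwork f).VertexEquiv a x y ↔ x = y := by
  constructor
  · rintro ⟨α, π, hα, hxy⟩
    rwa [inducedNetwork_isAut f hα.1] at hxy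
  · intro hxy
    exact ⟨1, 1, ⟨IsAut.one _, rfl⟩, hxy⟩

/-- The algorithm associated to `f`: one robot on the network induced by `f` moves from any
vertex `x` to `f x`. (All classes of indistinguishable vertices are singletons there.) -/
def associatedAlgorithm {n : ℕ} (f : Fin n → Fin n) : Algorithm (inducedNetwork f) 1 where
  dest C U :=
    { toSet := fun a => f '' U.toSet a
      isClass := fun a => by
        obtain ⟨x, hx⟩ := U.isClass a
        have hx' : ∀ y, y ∈ U.toSet a ↔ x = y := fun y => by
          rw [hx]
          exact inducedNetwork_vertexEquiv f a.1 x y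
        refine ⟨f x, Set.ext fun y => Iff.trans ?_ (inducedNetwork_vertexEquiv f a.1 (f x) y).symm⟩
        constructor
        · rintro ⟨z, hz, rfl⟩
          exact congrArg f ((hx' z).1 hz)
        · intro hy
          exact ⟨x, (hx' x).2 rfl, hy⟩
      equivariant := fun a₁ a₂ α π h => by
        have hα : ⇑α = id := funext (inducedNetwork_isAut f h.1)
        have h₁ := U.equivariant a₁ a₂ α π h
        rw [hα, Set.image_id] at h₁ ⊢
        rw [h₁] }
  reachable C U a x hx := ⟨f x, ⟨x, hx, rfl⟩, Or.inr (Or.inl rfl)⟩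

/-- The system `Ψ` computes `f`: some algorithm under `Ψ` simulates the algorithm associated
to `f` under the fully synchronous system of one robot on the network induced by `f`. -/
def RobotSystem.Computes (Ψ : RobotSystem.{u}) {n : ℕ} (f : Fin n → Fin n) : Prop :=
  ∃ A : Algorithm Ψ.G Ψ.k,
    Simulates Ψ A (FS (inducedNetwork f) 1 le_rfl) (associatedAlgorithm f)

/-- Universality of a set of systems. -/
def Universal (Y : Set RobotSystem.{u}) : Prop :=
  ∀ n : ℕ, 1 ≤ n → ∀ f : Fin n → Fin n, ∃ Ψ ∈ Y, Ψ.Computes f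

/-! Two paths with common ends and total length below the girth coincide, since their union has too
few edges to contain a cycle. Hence arcs of a shortest cycle shorter than half the girth are unique
geodesics. Three robots on such a cycle, with gaps below half the girth lying in pairwise disjoint
intervals, are told apart by their distances, and the geodesics joining them recover the cycle. So
every symmetry of the configuration fixes the cycle pointwise, and the robots can be steered
individually (`threeOn_rigid`, `Algorithm.eq_of_yields_ofMoves`).

One robot stays put; the offsets of the other two encode a flag and two registers `a`, `b` of a
machine iterating `f`. While `b` holds the value, `a` walks to `f b`; the flag flips and `a` becomes
the value; `b` walks to `a`; the flag flips back. Each machine step displaces each robot by at most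
one vertex, and the value changes only at the first flip, which recurs forever
(`WireState.exists_value_iterate`, `WireState.pos_step`). Reading off the value is the simulation
map. -/

/-! ### Short paths and shortest cycles -/

namespace SimpleGraph

variable {W : Type*} {S : SimpleGraph W}

/-- Two paths with the same ends whose total length is below the girth coincide. -/
theorem Walk.IsPath.eq_of_length_add_lt_egirth {x y : W} {p q : S.Walk x y} (hp : p.IsPath)
    (hq : q.IsPath) (h : ((p.length + q.length : ℕ) : ℕ∞) < S.egirth) : p = q := by
  classical
  let E : Finset (Sym2 W) := p.edges.toFinset ∪ q.edges.toFinset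
  let H : SimpleGraph W := fromEdgeSet (E : Set (Sym2 W))
  have hE : ∀ e ∈ E, e ∈ S.edgeSet := fun e he => by
    rcases Finset.mem_union.1 he with he | he
    · exact p.edges_subset_edgeSet (List.mem_toFinset.1 he)
    · exact q.edges_subset_edgeSet (List.mem_toFinset.1 he)
  have hH : ∀ e, e ∈ H.edgeSet ↔ e ∈ E := fun e => by
    simp only [H, edgeSet_fromEdgeSet, Set.mem_sdiff, Finset.mem_coe]
    exact ⟨fun h => h.1, fun h => ⟨h, fun hd => S.not_isDiag_of_mem_edgeSet (hE e h) hd⟩⟩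
  -- A cycle in the union of the two paths would be a cycle of `S` with at most `p.length +
  -- q.length` edges. Paths in a forest are unique.
  have hacyc : H.IsAcyclic := by
    intro v w hw
    have hwS : ∀ e ∈ w.edges, e ∈ S.edgeSet := fun e he =>
      hE e ((hH e).1 (w.edges_subset_edgeSet he))
    have h₁ : S.egirth ≤ ((w.transfer S hwS).length : ℕ∞) :=
      egirth_le_length (hw.transfer hwS)
    rw [Walk.length_transfer] at h₁
    have h₂ : w.length ≤ E.card := by
      rw [← Walk.length_edges, ← List.toFinset_card_of_nodup hw.edges_nodup]
      refine Finset.card_le_card fun e he => ?_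
      exact (hH e).1 (w.edges_subset_edgeSet (List.mem_toFinset.1 he))
    have h₃ : E.card ≤ p.length + q.length := by
      refine (Finset.card_union_le _ _).trans (Nat.add_le_add ?_ ?_)
      · exact (List.toFinset_card_le _).trans_eq p.length_edges
      · exact (List.toFinset_card_le _).trans_eq q.length_edges
    have h₄ : (w.length : ℕ∞) ≤ ((p.length + q.length : ℕ) : ℕ∞) := by
      exact_mod_cast h₂.trans h₃
    exact absurd (h₁.trans h₄) (not_le.2 h)
  have hpH : ∀ e ∈ p.edges, e ∈ H.edgeSet := fun e he =>
    (hH e).2 (Finset.mem_union_left _ (List.mem_toFinset.2 he))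
  have hqH : ∀ e ∈ q.edges, e ∈ H.edgeSet := fun e he =>
    (hH e).2 (Finset.mem_union_right _ (List.mem_toFinset.2 he))
  have key := (hacyc.subsingleton_path x y).elim ⟨p.transfer H hpH, hp.transfer hpH⟩
    ⟨q.transfer H hqH, hq.transfer hqH⟩
  have key' : p.transfer H hpH = q.transfer H hqH := congrArg Subtype.val key
  have hback : ∀ (r : S.Walk x y) (hr : ∀ e ∈ r.edges, e ∈ H.edgeSet),
      ∀ i, (r.transfer H hr).getVert i = r.getVert i := fun r hr i => by
    rw [Walk.getVert_eq_getD_support, Walk.getVert_eq_getD_support, Walk.support_transfer]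
  refine Walk.ext_getVert fun i => ?_
  rw [← hback p hpH, ← hback q hqH, key']

/-- A geodesic with the same ends is no longer than `p`, so the two lengths add up to less than the
girth and the paths coincide. -/
theorem Walk.IsPath.length_eq_dist_of_lt_egirth {x y : W} {p : S.Walk x y} (hp : p.IsPath)
    (h : ((2 * p.length : ℕ) : ℕ∞) < S.egirth) : S.dist x y = p.length := by
  obtain ⟨q, hq, hl⟩ := (Walk.reachable p).exists_path_of_dist
  have hle := dist_le p
  rw [← hl, hp.eq_of_length_add_lt_egirth hq (lt_of_le_of_lt ?_ h)]
  exact_mod_cast (by omega : p.length + q.length ≤ 2 * p.length)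

/-- The sequence `c` runs once around a cycle of length `g`, starting and ending at `c 0`. -/
structure IsCycleMap (S : SimpleGraph W) (g : ℕ) (c : ℕ → W) : Prop where
  closed : c 0 = c g
  adj : ∀ i < g, S.Adj (c i) (c (i + 1))
  injOn : Set.InjOn c {i | i < g}
  injOn' : Set.InjOn c {i | 1 ≤ i ∧ i ≤ g}

theorem Walk.IsCycle.isCycleMap {x : W} {w : S.Walk x x} (hw : w.IsCycle) :
    S.IsCycleMap w.length w.getVert where
  closed := by simp
  adj i hi := w.adj_getVert_succ hi
  injOn i hi j hj h := by
    refine hw.getVert_injOn' ?_ ?_ h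
    · simp only [Set.mem_ofPred_eq] at hi ⊢; omega
    · simp only [Set.mem_ofPred_eq] at hj ⊢; omega
  injOn' := hw.getVert_injOn

theorem exists_walk_of_forall_adj (c : ℕ → W) (i l : ℕ)
    (h : ∀ k < l, S.Adj (c (i + k)) (c (i + k + 1))) :
    ∃ p : S.Walk (c i) (c (i + l)), p.length = l ∧ ∀ k ≤ l, p.getVert k = c (i + k) := by
  induction l with
  | zero => exact ⟨.nil, rfl, fun k hk => by simp [Nat.le_zero.1 hk]⟩
  | succ l ih =>
    obtain ⟨p, hp, hv⟩ := ih fun k hk => h k (by omega)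
    refine ⟨p.concat (h l (Nat.lt_succ_self l)), by simp [hp], fun k hk => ?_⟩
    rw [Walk.concat_eq_append, Walk.getVert_append]
    split_ifs with hlt
    · exact hv k (by omega)
    · rcases Nat.le_succ_iff_eq_or_le.1 hk with rfl | hk
      · simp [hp]
      · have hkl : k = l := by omega
        subst hkl
        simp [hp]

namespace IsCycleMap

variable {g : ℕ} {c d : ℕ → W}

theorem exists_path (hc : S.IsCycleMap g c) {i j : ℕ} (hij : i ≤ j) (hj : j ≤ g)
    (hlt : j - i < g) :
    ∃ p : S.Walk (c i) (c j), p.IsPath ∧ p.length = j - i ∧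
      ∀ k ≤ j - i, p.getVert k = c (i + k) := by
  obtain ⟨p, hp, hv⟩ := exists_walk_of_forall_adj (S := S) c i (j - i)
    fun k hk => hc.adj _ (by omega)
  have hpath : p.IsPath := by
    rw [← Walk.IsPath.getVert_injOn_iff]
    intro k hk l hl h
    simp only [Set.mem_ofPred_eq, hp] at hk hl
    rw [hv k hk, hv l hl] at h
    -- An arc ending at `c g = c 0` cannot start at index `0`, because it is shorter than `g`;
    -- `injOn'` covers this case.
    rcases Nat.eq_or_lt_of_le hj with rfl | hj
    · have := hc.injOn' (x₁ := i + k) (x₂ := i + l) ⟨by omega, by omega⟩ ⟨by omega, by omega⟩ h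
      omega
    · have := hc.injOn (x₁ := i + k) (x₂ := i + l) (show i + k < g by omega) (show i + l < g by omega) h
      omega
  have hend : i + (j - i) = j := by omega
  refine ⟨p.copy rfl (congrArg c hend), ?_, ?_, ?_⟩
  · simpa using hpath
  · simpa using hp
  · simpa using hv

theorem dist_eq (hc : S.IsCycleMap g c) (hg : S.egirth = g) {i j : ℕ} (hij : i ≤ j)
    (hj : j ≤ g) (hlt : 2 * (j - i) < g) : S.dist (c i) (c j) = j - i := by
  obtain ⟨p, hp, hl, -⟩ := hc.exists_path hij hj (by omega)
  rw [hp.length_eq_dist_of_lt_egirth (by rw [hg, hl]; exact_mod_cast hlt), hl]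

/-- Two shortest cycles that agree at the ends of an arc shorter than half of the girth
agree on that arc. -/
theorem eqOn_arc (hc : S.IsCycleMap g c) (hd : S.IsCycleMap g d) (hg : S.egirth = g) {i j : ℕ}
    (hij : i ≤ j) (hj : j ≤ g) (hlt : 2 * (j - i) < g) (hi' : c i = d i) (hj' : c j = d j)
    {k : ℕ} (hik : i ≤ k) (hkj : k ≤ j) : c k = d k := by
  obtain ⟨p, hp, hpl, hpv⟩ := hc.exists_path hij hj (by omega)
  obtain ⟨q, hq, hql, hqv⟩ := hd.exists_path hij hj (by omega)
  have h : p = q.copy hi'.symm hj'.symm := by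
    refine hp.eq_of_length_add_lt_egirth (by simpa using hq) ?_
    rw [hg, Walk.length_copy, hpl, hql]
    exact_mod_cast (by omega : j - i + (j - i) < g)
  have h₁ := hpv (k - i) (by omega)
  have h₂ := hqv (k - i) (by omega)
  rw [h, Walk.getVert_copy, h₂, Nat.add_sub_of_le hik] at h₁
  exact h₁.symm

end IsCycleMap

end SimpleGraph

/-! ### Rigidity of three robots on a shortest cycle -/

/-- Positions of two robots on a cycle of length `g` whose three gaps, together with that
of a third robot at position `0`, lie in disjoint intervals below `g / 2`. -/
structure GapRegion (L g r₁ r₂ : ℕ) : Prop where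
  -- With `q = g / 3`, the gaps lie in `[q - 8L, q - 7L]`, `[q - 4L, q - 2L]` and `[q + 10L, q + 11L
  -- + 2]`.
  large : 100 * L + 100 ≤ g
  le₁ : g / 3 ≤ r₁ + 8 * L
  ge₁ : r₁ + 7 * L ≤ g / 3
  le₂ : 2 * (g / 3) ≤ r₂ + 11 * L
  ge₂ : r₂ + 10 * L ≤ 2 * (g / 3)
  pos : 1 ≤ L

/-- Three robots at the positions `0`, `r₁`, `r₂` of a cycle. -/
def threeOn {W : Type*} (c : ℕ → W) (r₁ r₂ : ℕ) : Fin 3 → W := ![c 0, c r₁, c r₂]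

theorem threeOn_injective {W : Type*} {S : SimpleGraph W} {L g : ℕ} {c : ℕ → W} {r₁ r₂ : ℕ}
    (hc : S.IsCycleMap g c) (hr : GapRegion L g r₁ r₂) :
    Function.Injective (threeOn c r₁ r₂) := by
  obtain ⟨h₀, h₁, h₂, h₃, h₄, h₅⟩ := hr
  have key : ∀ i j, i < g → j < g → c i = c j → i = j := fun i j hi hj h => hc.injOn hi hj h
  intro i j h
  fin_cases i <;> fin_cases j <;> simp [threeOn] at h ⊢ <;>
    · have := key _ _ (by omega) (by omega) h
      omega

/-- A placement of three robots on a shortest cycle with gaps in the region determines the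
cycle and the positions. -/
theorem threeOn_rigid {W : Type*} {S : SimpleGraph W} {L g : ℕ} {c d : ℕ → W}
    {r₁ r₂ s₁ s₂ : ℕ} (hg : S.egirth = g) (hc : S.IsCycleMap g c) (hd : S.IsCycleMap g d)
    (hr : GapRegion L g r₁ r₂) (hs : GapRegion L g s₁ s₂) (π : Equiv.Perm (Fin 3))
    (h : threeOn c r₁ r₂ = threeOn d s₁ s₂ ∘ π) :
    r₁ = s₁ ∧ r₂ = s₂ ∧ ∀ i ≤ g, c i = d i := by
  obtain ⟨a₀, a₁, a₂, a₃, a₄, a₅⟩ := hr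
  obtain ⟨b₀, b₁, b₂, b₃, b₄, b₅⟩ := hs
  have c₁ := hc.dist_eq hg (i := 0) (j := r₁) (by omega) (by omega) (by omega)
  have c₂ := hc.dist_eq hg (i := r₁) (j := r₂) (by omega) (by omega) (by omega)
  have c₃ := hc.dist_eq hg (i := r₂) (j := g) (by omega) (by omega) (by omega)
  have d₁ := hd.dist_eq hg (i := 0) (j := s₁) (by omega) (by omega) (by omega)
  have d₂ := hd.dist_eq hg (i := s₁) (j := s₂) (by omega) (by omega) (by omega)
  have d₃ := hd.dist_eq hg (i := s₂) (j := g) (by omega) (by omega) (by omega)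
  rw [← hc.closed] at c₃
  rw [← hd.closed] at d₃
  have d₁' := d₁
  have d₂' := d₂
  have d₃' := d₃
  rw [SimpleGraph.dist_comm] at d₁' d₂' d₃'
  have h₀ := congrFun h 0
  have h₁ := congrFun h 1
  have h₂ := congrFun h 2
  simp only [Function.comp_apply] at h₀ h₁ h₂
  have hπ : c 0 = d 0 ∧ c r₁ = d s₁ ∧ c r₂ = d s₂ := by
    generalize π 0 = i at h₀
    generalize π 1 = j at h₁
    generalize π 2 = k at h₂
    have e₀ : threeOn c r₁ r₂ 0 = c 0 := rfl
    have e₁ : threeOn c r₁ r₂ 1 = c r₁ := rfl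
    have e₂ : threeOn c r₁ r₂ 2 = c r₂ := rfl
    have f₀ : threeOn d s₁ s₂ 0 = d 0 := rfl
    have f₁ : threeOn d s₁ s₂ 1 = d s₁ := rfl
    have f₂ : threeOn d s₁ s₂ 2 = d s₂ := rfl
    rw [e₀] at h₀
    rw [e₁] at h₁
    rw [e₂] at h₂
    rw [h₀, h₁] at c₁
    rw [h₁, h₂] at c₂
    rw [h₂, h₀] at c₃
    rw [h₀, h₁, h₂]
    have s₀ : S.dist (d 0) (d 0) = 0 := SimpleGraph.dist_self
    have s₁' : S.dist (d s₁) (d s₁) = 0 := SimpleGraph.dist_self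
    have s₂' : S.dist (d s₂) (d s₂) = 0 := SimpleGraph.dist_self
    -- Of the 27 index triples only the identity survives: a repeated index makes a positive gap
    -- zero, and any other permutation puts a gap into two disjoint intervals.
    obtain rfl | rfl | rfl : i = 0 ∨ i = 1 ∨ i = 2 := by fin_cases i <;> simp
    all_goals
      obtain rfl | rfl | rfl : j = 0 ∨ j = 1 ∨ j = 2 := by fin_cases j <;> simp
      all_goals
        obtain rfl | rfl | rfl : k = 0 ∨ k = 1 ∨ k = 2 := by fin_cases k <;> simp
        all_goals
          simp only [f₀, f₁, f₂] at c₁ c₂ c₃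
          first
          | exact ⟨f₀, f₁, f₂⟩
          | (exfalso; omega)
  clear h₀ h₁ h₂
  obtain ⟨h₀, h₁, h₂⟩ := hπ
  rw [h₀, h₁, d₁] at c₁
  rw [h₀, h₂, d₃] at c₃
  obtain rfl : r₁ = s₁ := by omega
  obtain rfl : r₂ = s₂ := by omega
  refine ⟨rfl, rfl, fun i hi => ?_⟩
  have hg' : c g = d g := by rw [← hc.closed, ← hd.closed, h₀]
  by_cases hi₁ : i ≤ r₁
  · exact hc.eqOn_arc hd hg (by omega) (by omega) (by omega) h₀ h₁ (Nat.zero_le i) hi₁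
  by_cases hi₂ : i ≤ r₂
  · exact hc.eqOn_arc hd hg (by omega) (by omega) (by omega) h₁ h₂ (by omega) hi₂
  · exact hc.eqOn_arc hd hg (by omega) (by omega) (by omega) h₂ hg' (by omega) hi

/-! ### The machine and its encoding by positions -/

/-- A state of the machine iterating `f`. A state `(false, a, b)` holds the value `b` while `a`
moves towards `f b`; a state `(true, a, b)` holds the value `a` while `b` moves towards `a`. -/
abbrev WireState (n : ℕ) : Type := Bool × Fin n × Fin n

namespace WireState

variable {n : ℕ}

/-- One step from `a` towards `t`. -/
def toward (a t : Fin n) : Fin n :=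
  ⟨if a.val < t.val then a.val + 1 else if t.val < a.val then a.val - 1 else a.val, by
    split_ifs <;> omega⟩

theorem toward_val (a t : Fin n) : (toward a t).val =
    if a.val < t.val then a.val + 1 else if t.val < a.val then a.val - 1 else a.val := rfl

/-- The value held by a state. -/
def value : WireState n → Fin n
  | (false, _, b) => b
  | (true, a, _) => a

/-- The transition function. -/
def step (f : Fin n → Fin n) : WireState n → WireState n
  | (false, a, b) => if a = f b then (true, a, b) else (false, toward a (f b), b)
  | (true, a, b) => if b = a then (false, a, b) else (true, a, toward b a)

/-- The states from which the next step applies `f` to the value. -/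
def Tick (f : Fin n → Fin n) (t : WireState n) : Prop := t.1 = false ∧ t.2.1 = f t.2.2

theorem value_step_of_tick {f : Fin n → Fin n} {t : WireState n} (h : Tick f t) :
    value (step f t) = f (value t) := by
  obtain ⟨s, a, b⟩ := t
  obtain ⟨rfl, rfl : a = f b⟩ := h
  simp [step, value]

theorem value_step_of_not_tick {f : Fin n → Fin n} {t : WireState n} (h : ¬ Tick f t) :
    value (step f t) = value t := by
  obtain ⟨s, a, b⟩ := t
  cases s
  · have h' : a ≠ f b := fun e => h ⟨rfl, e⟩
    simp [step, value, h']
  · by_cases e : b = a <;> simp [step, value, e]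

/-- A bound on the number of steps before the next tick. -/
def delay (f : Fin n → Fin n) : WireState n → ℕ
  | (false, a, b) => (a.val - (f b).val) + ((f b).val - a.val)
  -- The summand `n` pays for the flip at `b = a`, after which the distance from `a` to `f b` is
  -- below `n`.
  | (true, a, b) => n + ((a.val - b.val) + (b.val - a.val))

theorem delay_step_lt {f : Fin n → Fin n} {t : WireState n} (h : ¬ Tick f t) :
    delay f (step f t) < delay f t := by
  obtain ⟨s, a, b⟩ := t
  cases s
  · have h' : a ≠ f b := fun e => h ⟨rfl, e⟩
    have h'' : a.val ≠ (f b).val := fun e => h' (Fin.ext e)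
    simp only [step, h', if_false, delay, toward_val]
    split_ifs <;> omega
  · by_cases e : b = a
    · subst e
      simp only [step, if_true, delay]
      omega
    · have e' : b.val ≠ a.val := fun h => e (Fin.ext h)
      simp only [step, e, if_false, delay, toward_val]
      split_ifs <;> omega

theorem exists_tick (f : Fin n → Fin n) (t : WireState n) : ∃ m, Tick f ((step f)^[m] t) := by
  induction h : delay f t using Nat.strong_induction_on generalizing t with
  | _ d ih =>
    by_cases ht : Tick f t
    · exact ⟨0, ht⟩
    · obtain ⟨m, hm⟩ := ih _ (h ▸ delay_step_lt ht) (step f t) rfl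
      exact ⟨m + 1, hm⟩

open Classical in
/-- The machine iterates `f`. -/
theorem exists_value_iterate (f : Fin n → Fin n) (t : WireState n) :
    ∃ σ : ℕ → ℕ, Monotone σ ∧ Function.Surjective σ ∧
      ∀ i, value ((step f)^[i] t) = f^[σ i] (value t) := by
  let p : ℕ → Prop := fun i => Tick f ((step f)^[i] t)
  have hinf : (Set.ofPred p).Infinite := by
    refine Set.infinite_of_forall_exists_gt fun N => ?_
    obtain ⟨m, hm⟩ := exists_tick f ((step f)^[N + 1] t)
    refine ⟨m + (N + 1), ?_, by omega⟩
    change Tick f _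
    rwa [Function.iterate_add_apply]
  -- `σ i` counts the ticks before time `i`; it is onto because ticks recur.
  refine ⟨Nat.count p, Nat.count_monotone p,
    fun k => ⟨Nat.nth p k, Nat.count_nth_of_infinite hinf k⟩, fun i => ?_⟩
  induction i with
  | zero => simp
  | succ i ih =>
    rw [Function.iterate_succ_apply', Nat.count_succ]
    by_cases h : p i
    · rw [value_step_of_tick h, ih, if_pos h, Function.iterate_succ_apply']
    · rw [value_step_of_not_tick h, ih, if_neg h, Nat.add_zero]

/-- The position of the second robot. -/
def pos₁ (g : ℕ) (t : WireState n) : ℕ :=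
  g / 3 - 16 * n + t.2.1.val + t.2.2.val + (if t.1 then 1 else 0)

/-- The position of the third robot. -/
def pos₂ (g : ℕ) (t : WireState n) : ℕ :=
  2 * (g / 3) - 22 * n + t.2.1.val + (n - t.2.2.val)

/-- Both offsets lie between `0` and `2 * n`, which is the width `L`; the shifts `16 * n` and `22 *
n` are `8 * L` and `11 * L`. -/
theorem gapRegion {g : ℕ} (hg : 200 * n + 100 ≤ g) (t : WireState n) :
    GapRegion (2 * n) g (pos₁ g t) (pos₂ g t) := by
  obtain ⟨s, a, b⟩ := t
  have := a.isLt
  have := b.isLt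
  constructor <;> (try simp only [pos₁, pos₂]) <;> try split_ifs
  all_goals omega

/-- The two offsets sum to `2 * a + n` plus the flag. Parity gives the flag, then the sum gives `a`,
and either offset gives `b`. -/
theorem eq_of_pos_eq {g : ℕ} {t t' : WireState n} (h₁ : pos₁ g t = pos₁ g t')
    (h₂ : pos₂ g t = pos₂ g t') : t = t' := by
  obtain ⟨s, a, b⟩ := t
  obtain ⟨s', a', b'⟩ := t'
  have := b.isLt
  have := b'.isLt
  have key : s = s' ∧ a.val = a'.val ∧ b.val = b'.val := by
    simp only [pos₁, pos₂] at h₁ h₂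
    cases s <;> cases s' <;> simp at h₁ ⊢ <;> omega
  obtain ⟨rfl, ha, hb⟩ := key
  rw [Fin.ext ha, Fin.ext hb]

/-- A unit change of `a` moves both robots the same way, a unit change of `b` moves them opposite
ways, and a flip moves only the second robot. -/
theorem pos_step (f : Fin n → Fin n) (g : ℕ) (t : WireState n) :
    (pos₁ g (step f t) ≤ pos₁ g t + 1 ∧ pos₁ g t ≤ pos₁ g (step f t) + 1) ∧
      pos₂ g (step f t) ≤ pos₂ g t + 1 ∧ pos₂ g t ≤ pos₂ g (step f t) + 1 := by
  obtain ⟨s, a, b⟩ := t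
  have := b.isLt
  cases s
  · by_cases e : a = f b
    · simp only [step, e, if_true, pos₁, pos₂, Bool.false_eq_true, if_false]
      omega
    · simp only [step, e, if_false, pos₁, pos₂, toward_val]
      split_ifs <;> omega
  · by_cases e : b = a
    · simp only [step, e, if_true, pos₁, pos₂, Bool.false_eq_true, if_false]
      omega
    · simp only [step, e, if_false, pos₁, pos₂, toward_val]
      split_ifs <;> omega

end WireState

/-! ### Classes of vertices and algorithms given by moves -/

namespace Network

variable {G : Network.{u}} {k : ℕ}

theorem EquivUnder.refl (a : G.Arrangement k) : G.EquivUnder a a 1 1 := ⟨IsAut.one G, rfl⟩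

theorem EquivUnder.trans {a₁ a₂ a₃ : G.Arrangement k} {α β : Equiv.Perm G.V}
    {π ρ : Equiv.Perm (Fin k)} (h : G.EquivUnder a₁ a₂ α π) (h' : G.EquivUnder a₂ a₃ β ρ) :
    G.EquivUnder a₁ a₃ (β * α) (ρ * π) := by
  refine ⟨h'.1.mul h.1, funext fun r => ?_⟩
  have h₁ := congrFun h.2 r
  have h₂ := congrFun h'.2 (π r)
  simp only [Function.comp_apply, Equiv.Perm.mul_apply] at h₁ h₂ ⊢
  rw [h₁, h₂]

theorem EquivUnder.symm {a₁ a₂ : G.Arrangement k} {α : Equiv.Perm G.V}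
    {π : Equiv.Perm (Fin k)} (h : G.EquivUnder a₁ a₂ α π) :
    G.EquivUnder a₂ a₁ α⁻¹ π⁻¹ := by
  refine ⟨h.1.inv, funext fun r => ?_⟩
  have h₁ : α (a₁ (π⁻¹ r)) = a₂ r := by simpa using congrFun h.2 (π⁻¹ r)
  change α⁻¹ (a₂ r) = a₁ (π⁻¹ r)
  rw [← h₁]
  simp

theorem toConfig_eq_iff {a₁ a₂ : G.Arrangement k} :
    G.toConfig a₁ = G.toConfig a₂ ↔ ∃ α π, G.EquivUnder a₁ a₂ α π :=
  Quotient.eq (r := G.arrangementSetoid k)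

theorem Config.Elem.exists_equivUnder {C : G.Config k} (a b : C.Elem) :
    ∃ α π, G.EquivUnder a.1 b.1 α π :=
  toConfig_eq_iff.1 (a.2.trans b.2.symm)

/-- The class of indistinguishable vertices containing the vertex `y` of the arrangement `b`. -/
def vertexClassOf {C : G.Config k} (b : C.Elem) (y : G.V) : VertexClass C where
  toSet a := {z | ∃ α π, G.EquivUnder b.1 a.1 α π ∧ α y = z}
  isClass a := by
    obtain ⟨α, π, h⟩ := b.exists_equivUnder a
    refine ⟨α y, Set.ext fun z => ⟨?_, ?_⟩⟩
    · rintro ⟨β, ρ, h', rfl⟩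
      exact ⟨β * α⁻¹, ρ * π⁻¹, h.symm.trans h', by simp⟩
    · rintro ⟨β, ρ, h', rfl⟩
      exact ⟨β * α, ρ * π, h.trans h', rfl⟩
  equivariant a₁ a₂ α π h := by
    refine Set.ext fun z => ⟨?_, ?_⟩
    · rintro ⟨_, ⟨β, ρ, h', rfl⟩, rfl⟩
      exact ⟨α * β, π * ρ, h'.trans h, rfl⟩
    · rintro ⟨β, ρ, h', rfl⟩
      exact ⟨α⁻¹ (β y), ⟨α⁻¹ * β, π⁻¹ * ρ, h'.trans h.symm, rfl⟩, by simp⟩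

theorem mem_vertexClassOf {C : G.Config k} (b : C.Elem) (y : G.V) :
    y ∈ (vertexClassOf b y).toSet b := ⟨1, 1, .refl _, rfl⟩

theorem VertexClass.exists_mem {C : G.Config k} (U : VertexClass C) (a : C.Elem) :
    ∃ x, x ∈ U.toSet a := by
  obtain ⟨x, hx⟩ := U.isClass a
  exact ⟨x, hx ▸ ⟨1, 1, .refl _, rfl⟩⟩

/-- A vertex of a class in one arrangement is carried to any vertex of that class in another
arrangement by an automorphism relating the two arrangements. -/
theorem VertexClass.exists_equivUnder {C : G.Config k} (U : VertexClass C) {a b : C.Elem}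
    {x y : G.V} (hx : x ∈ U.toSet a) (hy : y ∈ U.toSet b) :
    ∃ α π, G.EquivUnder a.1 b.1 α π ∧ α x = y := by
  obtain ⟨α, π, h⟩ := a.exists_equivUnder b
  have h₁ : α x ∈ U.toSet b := U.equivariant a b α π h ▸ ⟨x, hx, rfl⟩
  obtain ⟨z, hz⟩ := U.isClass b
  rw [hz] at h₁ hy
  obtain ⟨β, ρ, hβ, h₁⟩ := h₁
  obtain ⟨γ, τ, hγ, rfl⟩ := hy
  refine ⟨γ * (β⁻¹ * α), τ * (ρ⁻¹ * π), (h.trans hβ.symm).trans hγ, ?_⟩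
  simp [← h₁]

end Network

/-- The algorithm which, in a configuration containing the chosen arrangement `base C`, sends
the robots located at `x` there to the class of `move C x`. -/
noncomputable def Algorithm.ofMoves {G : Network.{u}} {k : ℕ} (base : ∀ C : G.Config k, C.Elem)
    (move : G.Config k → G.V → G.V)
    (hmove : ∀ C x, x = move C x ∨ G.Adj x (move C x)) : Algorithm G k where
  -- The choice of a vertex in the class is arbitrary, but harmless where symmetries fix the robots:
  -- their classes are then singletons.
  dest C U := vertexClassOf (base C) (move C (U.exists_mem (base C)).choose)
  reachable C U a x hx := by
    have hy := (U.exists_mem (base C)).choose_spec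
    generalize (U.exists_mem (base C)).choose = y at hy
    obtain ⟨α, π, h, rfl⟩ := U.exists_equivUnder hy hx
    refine ⟨α (move C y), ⟨α, π, h, rfl⟩, ?_⟩
    exact (hmove C y).imp (congrArg α) fun h' => (h.1.1 _ _).1 h'

/-- If the symmetries of the chosen arrangement fix the robots and their destinations, the
robots move as prescribed. -/
theorem Algorithm.eq_of_yields_ofMoves {G : Network.{u}} {k : ℕ} {base : ∀ C : G.Config k, C.Elem}
    {move : G.Config k → G.V → G.V} {hmove : ∀ C x, x = move C x ∨ G.Adj x (move C x)}
    {C C' : G.Config k} (hy : Yields (Algorithm.ofMoves base move hmove) C C')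
    (hfix : ∀ α π, G.EquivUnder (base C).1 (base C).1 α π →
      ∀ r, α ((base C).1 r) = (base C).1 r ∧ α (move C ((base C).1 r)) = move C ((base C).1 r)) :
    C' = G.toConfig fun r => move C ((base C).1 r) := by
  obtain ⟨a', ha'⟩ := hy (base C)
  rw [← a'.2]
  refine congrArg _ (funext fun r => ?_)
  obtain ⟨α, π, h, hr⟩ := (ha' r).2 _ (mem_vertexClassOf (base C) ((base C).1 r))
  rw [← hr]
  have hz := ((vertexClassOf (base C) ((base C).1 r)).exists_mem (base C)).choose_spec
  generalize ((vertexClassOf (base C) ((base C).1 r)).exists_mem (base C)).choose = z at hz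
  obtain ⟨β, ρ, hβ, rfl⟩ := hz
  rw [(hfix β ρ hβ r).1, (hfix α π h r).2]

/-! ### Rigidity up to automorphism, and the simulated executions -/

namespace Network

variable {G : Network.{u}}

theorem toSimpleGraph_egirth {m : ℕ} (hm : 2 ≤ m) (h : (m : ℕ∞) ≤ G.girth) :
    G.girth = G.toSimpleGraph.egirth := by
  unfold girth at h ⊢
  split_ifs with hl
  · rw [if_pos hl] at h
    have : m ≤ 1 := by exact_mod_cast h
    omega
  · rfl

theorem IsAut.isCycleMap {α : Equiv.Perm G.V} (h : G.IsAut α) {g : ℕ} {c : ℕ → G.V}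
    (hc : G.toSimpleGraph.IsCycleMap g c) : G.toSimpleGraph.IsCycleMap g (α ∘ c) where
  closed := congrArg α hc.closed
  adj i hi := ⟨fun e => (hc.adj i hi).1 (α.injective e), (h.1 _ _).1 (hc.adj i hi).2⟩
  injOn := α.injective.comp_injOn hc.injOn
  injOn' := α.injective.comp_injOn hc.injOn'

theorem comp_threeOn {W W' : Type*} (α : W → W') (c : ℕ → W) (r₁ r₂ : ℕ) :
    α ∘ threeOn c r₁ r₂ = threeOn (α ∘ c) r₁ r₂ := by
  funext i
  fin_cases i <;> rfl

/-- An automorphism carries a shortest cycle to a shortest cycle, so this reduces to `threeOn_rigid`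
for the image cycle. -/
theorem threeOn_rigid_of_equivUnder {L g : ℕ} (hg : G.toSimpleGraph.egirth = g)
    {c d : ℕ → G.V} (hc : G.toSimpleGraph.IsCycleMap g c) (hd : G.toSimpleGraph.IsCycleMap g d)
    {r₁ r₂ s₁ s₂ : ℕ} (hr : GapRegion L g r₁ r₂) (hs : GapRegion L g s₁ s₂)
    {α : Equiv.Perm G.V} {π : Equiv.Perm (Fin 3)}
    (h : G.EquivUnder (threeOn c r₁ r₂) (threeOn d s₁ s₂) α π) :
    r₁ = s₁ ∧ r₂ = s₂ ∧ ∀ i ≤ g, α (c i) = d i :=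
  threeOn_rigid hg (h.1.isCycleMap hc) hd hr hs π ((comp_threeOn α c r₁ r₂).symm.trans h.2)

theorem adj_or_eq_of_isCycleMap {g : ℕ} {c : ℕ → G.V} (hc : G.toSimpleGraph.IsCycleMap g c)
    {i j : ℕ} (hi : i ≤ g) (hj : j ≤ g) (h : j ≤ i + 1) (h' : i ≤ j + 1) :
    c i = c j ∨ G.Adj (c i) (c j) := by
  obtain rfl | rfl | rfl : i = j ∨ j = i + 1 ∨ i = j + 1 := by omega
  · exact Or.inl rfl
  · exact Or.inr (hc.adj i hj).2
  · exact Or.inr (G.symm _ _ (hc.adj j hi).2)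

end Network

/-- Iterating `f` is an execution of the algorithm associated to `f`. -/
theorem fullySynchronous_iterate {n : ℕ} (f : Fin n → Fin n) (x : Fin n) :
    fullySynchronous (inducedNetwork f) 1 (associatedAlgorithm f)
      fun j => (inducedNetwork f).toConfig fun _ => f^[j] x := by
  rintro j ⟨a, ha⟩
  obtain ⟨α, π, h, h'⟩ := toConfig_eq_iff.1 ha
  have hax : ∀ r, a r = f^[j] x := fun r => by
    have := congrFun h' r
    rwa [Function.comp_apply, inducedNetwork_isAut f h] at this
  have hf : ∀ r, f (a r) = f^[j + 1] x := fun r => by rw [hax, Function.iterate_succ_apply']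
  exact ⟨⟨fun _ => f^[j + 1] x, rfl⟩, fun r =>
    ⟨Or.inr (Or.inl (hf r).symm), fun U hU => ⟨a r, hU, hf r⟩⟩⟩

/-! ### Robots running the machine -/

namespace WireState

variable {G : Network.{u}} {n g : ℕ}

/-- The arrangement of three robots on a cycle that represents a state. -/
def arrangement (G : Network.{u}) (g : ℕ) (c : ℕ → G.V) (t : WireState n) : G.Arrangement 3 :=
  threeOn c (pos₁ g t) (pos₂ g t)

theorem exists_arrangement_eq (hg : 200 * n + 100 ≤ g) (c : ℕ → G.V) (t : WireState n)
    (r : Fin 3) : ∃ i ≤ g, arrangement G g c t r = c i := by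
  obtain ⟨h₀, h₁, h₂, h₃, h₄, h₅⟩ := t.gapRegion hg
  fin_cases r
  · exact ⟨0, by omega, rfl⟩
  · exact ⟨pos₁ g t, by omega, rfl⟩
  · exact ⟨pos₂ g t, by omega, rfl⟩

/-- This makes decoding well defined. With `c = d` it also shows that symmetries fix the robots and
their destinations, all of which lie on the cycle. -/
theorem arrangement_rigid (hg : 200 * n + 100 ≤ g) (hG : G.toSimpleGraph.egirth = g)
    {c d : ℕ → G.V} (hc : G.toSimpleGraph.IsCycleMap g c) (hd : G.toSimpleGraph.IsCycleMap g d)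
    {s t : WireState n} {α : Equiv.Perm G.V} {π : Equiv.Perm (Fin 3)}
    (h : G.EquivUnder (arrangement G g c s) (arrangement G g d t) α π) :
    s = t ∧ ∀ i ≤ g, α (c i) = d i := by
  obtain ⟨h₁, h₂, h₃⟩ := threeOn_rigid_of_equivUnder hG hc hd (s.gapRegion hg) (t.gapRegion hg) h
  exact ⟨eq_of_pos_eq h₁ h₂, h₃⟩

theorem arrangement_step (hg : 200 * n + 100 ≤ g) {c : ℕ → G.V}
    (hc : G.toSimpleGraph.IsCycleMap g c) (f : Fin n → Fin n) (t : WireState n) (r : Fin 3) :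
    arrangement G g c t r = arrangement G g c (step f t) r ∨
      G.Adj (arrangement G g c t r) (arrangement G g c (step f t) r) := by
  obtain ⟨h₀, h₁, h₂, h₃, h₄, h₅⟩ := t.gapRegion hg
  obtain ⟨k₀, k₁, k₂, k₃, k₄, k₅⟩ := (step f t).gapRegion hg
  obtain ⟨⟨p₁, p₂⟩, p₃, p₄⟩ := pos_step f g t
  fin_cases r
  · exact Or.inl rfl
  · exact adj_or_eq_of_isCycleMap hc (by omega) (by omega) p₁ p₂
  · exact adj_or_eq_of_isCycleMap hc (by omega) (by omega) p₃ p₄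

open Classical in
/-- In every configuration there are an arrangement and moves of its robots that carry out a
step of the machine if the configuration represents a state. -/
theorem exists_base_move (hg : 200 * n + 100 ≤ g) (hG : G.toSimpleGraph.egirth = g)
    (f : Fin n → Fin n) (C : G.Config 3) :
    ∃ (b : C.Elem) (move : G.V → G.V), (∀ x, x = move x ∨ G.Adj x (move x)) ∧
      ∀ (d : ℕ → G.V) (t : WireState n), G.toSimpleGraph.IsCycleMap g d →
        G.toConfig (arrangement G g d t) = C →
        ∃ c, G.toSimpleGraph.IsCycleMap g c ∧ b.1 = arrangement G g c t ∧
          ∀ r, move (b.1 r) = arrangement G g c (step f t) r := by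
  by_cases h : ∃ (c : ℕ → G.V) (t : WireState n), G.toSimpleGraph.IsCycleMap g c ∧
      G.toConfig (arrangement G g c t) = C
  · obtain ⟨c, t, hc, rfl⟩ := h
    have hinj : Function.Injective (arrangement G g c t) :=
      threeOn_injective hc (t.gapRegion hg)
    -- A move depends on the vertex only; since the robots occupy distinct vertices, the vertex
    -- identifies the robot.
    refine ⟨⟨arrangement G g c t, rfl⟩, fun x =>
      if hx : ∃ r, arrangement G g c t r = x then arrangement G g c (step f t) hx.choose else x,
      fun x => ?_, fun d s hd hs => ⟨c, hc, ?_⟩⟩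
    · by_cases hx : ∃ r, arrangement G g c t r = x
      · have := arrangement_step hg hc f t hx.choose
        rw [hx.choose_spec] at this
        simp only [dif_pos hx]
        exact this
      · exact Or.inl (by simp only [dif_neg hx])
    · obtain ⟨α, π, h⟩ := toConfig_eq_iff.1 hs
      obtain rfl := (arrangement_rigid hg hG hd hc h).1
      refine ⟨rfl, fun r => ?_⟩
      have hx : ∃ r', arrangement G g c s r' = arrangement G g c s r := ⟨r, rfl⟩
      change dite _ _ _ = _
      rw [dif_pos hx, hinj hx.choose_spec]
  · obtain ⟨a, ha⟩ := Quotient.exists_rep C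
    exact ⟨⟨a, ha⟩, id, fun x => Or.inl rfl, fun d t hd ht => absurd ⟨d, t, hd, ht⟩ h⟩

open Classical in
/-- The configuration of the network of `f` encoded by a configuration that represents a
state. -/
noncomputable def decode (G : Network.{u}) (g : ℕ) (f : Fin n → Fin n) (C : G.Config 3) :
    Option ((inducedNetwork f).Config 1) :=
  if h : ∃ (t : WireState n) (c : ℕ → G.V), G.toSimpleGraph.IsCycleMap g c ∧
      G.toConfig (arrangement G g c t) = C
  then some ((inducedNetwork f).toConfig fun _ => value h.choose) else none

theorem decode_toConfig (hg : 200 * n + 100 ≤ g) (hG : G.toSimpleGraph.egirth = g)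
    (f : Fin n → Fin n) {c : ℕ → G.V} (hc : G.toSimpleGraph.IsCycleMap g c) (t : WireState n) :
    decode G g f (G.toConfig (arrangement G g c t)) =
      some ((inducedNetwork f).toConfig fun _ => value t) := by
  have h : ∃ (s : WireState n) (d : ℕ → G.V), G.toSimpleGraph.IsCycleMap g d ∧
      G.toConfig (arrangement G g d s) = G.toConfig (arrangement G g c t) := ⟨t, c, hc, rfl⟩
  obtain ⟨d, hd, hs⟩ := h.choose_spec
  obtain ⟨α, π, h'⟩ := toConfig_eq_iff.1 hs
  have hst := (arrangement_rigid hg hG hd hc h').1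
  unfold decode
  rw [dif_pos h, hst]

end WireState

open WireState in
/-- Three fully synchronous robots on a network of large finite girth compute `f`. -/
theorem computes_of_egirth {G : Network.{u}} {n g : ℕ} (hn : 1 ≤ n)
    (hg : 200 * n + 100 ≤ g) (hG : G.toSimpleGraph.egirth = g) (f : Fin n → Fin n) :
    (FS G 3 (by norm_num)).Computes f := by
  choose base move hmove hstep using exists_base_move hg hG f
  refine ⟨Algorithm.ofMoves base move hmove, decode G g f, fun C' => ?_, fun E hE => ?_⟩
  · change (inducedNetwork f).Config 1 at C'
    obtain ⟨a, rfl⟩ := Quotient.exists_rep C'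
    obtain ⟨v, w, hw, hl⟩ := SimpleGraph.exists_egirth_eq_length.2
      fun h => ENat.top_ne_natCast g ((SimpleGraph.egirth_eq_top.2 h).symm.trans hG)
    obtain rfl : g = w.length := by rw [hG] at hl; exact_mod_cast hl
    -- With flag `false` the value is the last component; the middle one is arbitrary.
    refine ⟨_, (decode_toConfig hg hG f hw.isCycleMap (false, a 0, a 0)).trans ?_⟩
    refine congrArg (fun b => some ((inducedNetwork f).toConfig b)) (funext fun r => ?_)
    rw [Subsingleton.elim r 0]
    rfl
  · by_cases h : ∃ (t : WireState n) (c : ℕ → G.V), G.toSimpleGraph.IsCycleMap g c ∧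
      G.toConfig (arrangement G g c t) = E 0
    · obtain ⟨t, c, hc, hE₀⟩ := h
      -- The cycle is allowed to vary with `i`: each chosen base arrangement may lie on a different
      -- image of it, but the state is the same.
      have hrep : ∀ i, ∃ d, G.toSimpleGraph.IsCycleMap g d ∧
          G.toConfig (arrangement G g d ((step f)^[i] t)) = E i := by
        intro i
        induction i with
        | zero => exact ⟨c, hc, hE₀⟩
        | succ i ih =>
          obtain ⟨d, hd, hi⟩ := ih
          obtain ⟨e, he, hb, hm⟩ := hstep (E i) d _ hd hi
          refine ⟨e, he, ?_⟩
          rw [Function.iterate_succ_apply']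
          have key := Algorithm.eq_of_yields_ofMoves (hE i) fun α π hα r => by
            rw [hm, hb]
            rw [hb] at hα
            have hfix := (arrangement_rigid hg hG he he hα).2
            obtain ⟨j, hj, hj'⟩ := exists_arrangement_eq hg e ((step f)^[i] t) r
            obtain ⟨k, hk, hk'⟩ :=
              exists_arrangement_eq hg e (step f ((step f)^[i] t)) r
            rw [hj', hk']
            exact ⟨hfix j hj, hfix k hk⟩
          rw [key]
          exact congrArg _ (funext fun r => (hm r).symm)
      obtain ⟨σ, hσ, hσ', hv⟩ := exists_value_iterate f t
      refine ⟨_, fullySynchronous_iterate f (value t), Or.inr ⟨σ, hσ, hσ', fun i => ?_⟩⟩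
      obtain ⟨d, hd, hi⟩ := hrep i
      rw [← hi, decode_toConfig hg hG f hd, hv]
      rfl
    -- Where decoding is undefined any execution will do; `1 ≤ n` supplies a starting vertex.
    · exact ⟨_, fullySynchronous_iterate f ⟨0, hn⟩, Or.inl (dif_neg h)⟩

theorem mainTheorem3 (G : ℕ → Network.{u})
    (hG : ∀ n : ℕ, (n : ℕ∞) ≤ (G n).girth ∧ (G n).girth ≠ ⊤) :
    Universal {Ψ : RobotSystem.{u} | ∃ n : ℕ, Ψ = FS (G n) 3 (by norm_num)} := by
  intro n hn f
  -- This is `100 * L + 100` for `L = 2 * n`; being at least `2`, it also rules out self-loops.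
  obtain ⟨h₁, h₂⟩ := hG (200 * n + 100)
  refine ⟨_, ⟨200 * n + 100, rfl⟩, ?_⟩
  have h₃ := toSimpleGraph_egirth (by omega) h₁
  obtain ⟨g, hg⟩ := ENat.ne_top_iff_exists.1 h₂
  rw [← hg] at h₁ h₃
  exact computes_of_egirth hn (by exact_mod_cast h₁) h₃.symm f
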